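/- Let $k$ be a field and let $G$ be a finite simple graph with vertex set $V_G=\{x_1,\dots,x_n\}$. Its cover ideal is $$J=J(G)=\bigcap_{\{x_i,x_j\}\in E_G}(x_i,x_j)\subseteq R=k[x_1,\dots,x_n]$$ (with $J=R$ if $G$ has no edges). For an ideal $I\subseteq R$, let $\operatorname{Ass}(R/I)$ be the set of prime ideals of the form $I:(T)=\{F\in R\mid FT\in I\}$ with $T\in R$; $I$ has the persistence property if $\operatorname{Ass}(R/I^s)\subseteq\operatorname{Ass}(R/I^{s+1})$ for all $s\ge 1$. A finite simple graph $H$ is critically $s$-chromatic if $\chi(H)=s$ and $\chi(H\setminus x)=s-1$ for every vertex $x$ of $H$. For a set $W$ of vertices of $H$, the expansion $H[W]$ is the graph obtained by replacing each $w\in W$ by two adjacent vertices, both joined to (all copies of) the neighbours of $w$. For a positive integer $s$, consider the statement $C(s)$: for every finite simple graph $H$ that is critically $s$-chromatic there is a set $W\subseteq V_H$ such that $H[W]$ is critically $(s+1)$-chromatic. Let $s\ge 1$. If $C(s+1)$ holds, then $$\operatorname{Ass}(R/J^s)\subseteq \operatorname{Ass}(R/J^{s+1}).$$ In particular, if $C(s)$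 holds for all $s\ge 1$, then $J$ has the persistence property. -/

import Mathlib

namespace CoverIdeal

/-- `G` is critically `s`-chromatic: `χ(G) = s`, and `χ(G \ x) = s - 1` for every vertex `x`
(written without subtraction). -/
def IsCriticallyChromatic {V : Type*} (G : SimpleGraph V) (s : ℕ) : Prop :=
  G.chromaticNumber = (s : ℕ∞) ∧
    ∀ x : V, (G.induce {x}ᶜ).chromaticNumber + 1 = (s : ℕ∞)

/-- The vertex of `G` of which a vertex of the expansion is a copy. -/
def base {V : Type*} (W : Set V) : V ⊕ W → V := Sum.elim id Subtype.val

/-- The expansion `G[W]`: every vertex `w ∈ W` is replaced by two adjacent copies `inl w`, `inr w`,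
each joined to all copies of the neighbours of `w`; a vertex `v ∉ W` is kept as `inl v`. -/
def expansion {V : Type*} (G : SimpleGraph V) (W : Set V) : SimpleGraph (V ⊕ W) where
  Adj a b := a ≠ b ∧ (base W a = base W b ∨ G.Adj (base W a) (base W b))
  symm := ⟨fun _ _ h => ⟨h.1.symm, h.2.imp Eq.symm SimpleGraph.Adj.symm⟩⟩
  loopless := ⟨fun _ h => h.1 rfl⟩

/-- The conjecture on critical graphs for the integer `s`: every finite critically `s`-chromatic
graph has an expansion `G[W]` that is critically `(s+1)`-chromatic. -/
def ConjectureFor (s : ℕ) : Prop :=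
  ∀ (V : Type) [Finite V] (G : SimpleGraph V), IsCriticallyChromatic G s →
    ∃ W : Set V, IsCriticallyChromatic (expansion G W) (s + 1)

/-- The cover ideal of `G`: the intersection of the ideals `(x_i, x_j)` over all edges `{i, j}`. -/
noncomputable def coverIdeal (k : Type*) [Field k] {V : Type*} (G : SimpleGraph V) :
    Ideal (MvPolynomial V k) :=
  ⨅ (i : V) (j : V) (_ : G.Adj i j), Ideal.span {MvPolynomial.X i, MvPolynomial.X j}

/-- `Ass(R/I)`: the prime ideals of the form `I : (T) = {F | F * T ∈ I}` with `T ∈ R`. -/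
def Ass {R : Type*} [CommRing R] (I : Ideal R) : Set (Ideal R) :=
  {P | P.IsPrime ∧ ∃ T : R, (P : Set R) = {F | F * T ∈ I}}

/-- The persistence property: `Ass(R/I^s) ⊆ Ass(R/I^(s+1))` for all `s ≥ 1`. -/
def HasPersistenceProperty {R : Type*} [CommRing R] (I : Ideal R) : Prop :=
  ∀ s : ℕ, 1 ≤ s → Ass (I ^ s) ⊆ Ass (I ^ (s + 1))

end CoverIdeal

/-! The colon ideals of monomials into `J ^ s` encode colourings. A monomial `x^a` lies in `J ^ s`
iff `s` independent sets cover each `v` at least `s - a v` times, i.e. iff the blow-up of `G` with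
cliques of sizes `s - a v` is `s`-colourable (`monomial_mem_coverIdeal_pow_iff`,
`colorable_blowup_iff`). Hence a monomial prime is associated to `J ^ s` exactly when its variables
are the vertices under a critically `(s+1)`-chromatic blow-up with fibres of size at most `s`
(`exists_critical_blowup_of_mem_ass`, `mem_ass_of_critical_blowup`). An expansion of a blow-up is
again a blow-up over the same vertices, so the conjecture for `s + 1` carries the same prime from `J
^ s` to `J ^ (s + 1)`. -/

namespace CoverIdeal

open MvPolynomial

/-! ### Monomial ideals and their associated primes -/

section MonomialIdeal

variable {σ k : Type*} [Field k]

/-- An ideal that contains the monomials of each of its elements. -/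
def IsMonomialIdeal (I : Ideal (MvPolynomial σ k)) : Prop :=
  ∀ f ∈ I, ∀ a ∈ f.support, monomial a (1 : k) ∈ I

theorem monomial_mem_of_one {I : Ideal (MvPolynomial σ k)} {a : σ →₀ ℕ}
    (h : monomial a (1 : k) ∈ I) (c : k) : monomial a c ∈ I := by
  have : monomial a c = C c * monomial a (1 : k) := by rw [C_mul_monomial, mul_one]
  rw [this]
  exact I.mul_mem_left _ h

theorem mem_of_forall_monomial_mem {I : Ideal (MvPolynomial σ k)} {f : MvPolynomial σ k}
    (h : ∀ a ∈ f.support, monomial a (1 : k) ∈ I) : f ∈ I := by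
  rw [f.as_sum]
  exact I.sum_mem fun a ha => monomial_mem_of_one (h a ha) _

theorem monomial_mem_of_le {I : Ideal (MvPolynomial σ k)} {a b : σ →₀ ℕ} (hab : a ≤ b)
    (h : monomial a (1 : k) ∈ I) : monomial b (1 : k) ∈ I := by
  have : monomial b (1 : k) = monomial (b - a) 1 * monomial a (1 : k) := by
    rw [monomial_mul, mul_one, tsub_add_cancel_of_le hab]
  rw [this]
  exact I.mul_mem_left _ h

theorem IsMonomialIdeal.mul_monomial_mem {I : Ideal (MvPolynomial σ k)} (hI : IsMonomialIdeal I)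
    {f : MvPolynomial σ k} {a b : σ →₀ ℕ} (h : f * monomial a (1 : k) ∈ I) (hb : b ∈ f.support) :
    monomial (b + a) (1 : k) ∈ I := by
  refine hI _ h _ ?_
  rw [mem_support_iff, coeff_mul_monomial, mul_one]
  exact mem_support_iff.1 hb

theorem isMonomialIdeal_span_monomial (A : Set (σ →₀ ℕ)) :
    IsMonomialIdeal (Ideal.span ((fun a => monomial a (1 : k)) '' A)) := by
  intro f hf a ha
  obtain ⟨b, hb, hba⟩ := mem_ideal_span_monomial_image.1 hf a ha
  exact monomial_mem_of_le hba (Ideal.subset_span ⟨b, hb, rfl⟩)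

theorem card_support_sub_monomial_lt {f : MvPolynomial σ k} {a : σ →₀ ℕ} (ha : a ∈ f.support) :
    (f - monomial a (coeff a f)).support.card < f.support.card := by
  classical
  refine Finset.card_lt_card (Finset.ssubset_iff_of_subset ?_ |>.2 ⟨a, ha, ?_⟩)
  · intro b hb
    by_cases hab : a = b
    · exact hab ▸ ha
    · simpa [coeff_monomial, hab] using hb
  · simp

theorem card_support_monomial_mul_le (a : σ →₀ ℕ) (f : MvPolynomial σ k) :
    (monomial a (1 : k) * f).support.card ≤ f.support.card := by
  classical
  refine (Finset.card_le_card (support_mul _ _)).trans (Finset.card_add_le.trans ?_)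
  have : (monomial a (1 : k)).support.card ≤ 1 := by
    simpa using Finset.card_le_card (support_monomial_subset (s := a) (a := (1 : k)))
  exact (Nat.mul_le_mul_right _ this).trans (one_mul _).le

/-- An associated prime of a monomial ideal is monomial and is the colon ideal of a monomial. -/
theorem IsMonomialIdeal.exists_monomial_of_mem_ass [Finite σ] {I P : Ideal (MvPolynomial σ k)}
    (hI : IsMonomialIdeal I) (hP : P ∈ Ass I) :
    IsMonomialIdeal P ∧
      ∃ a : σ →₀ ℕ, ∀ F, F ∈ P ↔ F * monomial a (1 : k) ∈ I := by
  obtain ⟨hprime, T₀, hT₀⟩ := hP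
  let _ : LinearOrder σ := LinearOrder.lift' (Finite.equivFin σ) (Finite.equivFin σ).injective
  obtain ⟨m⟩ := Nonempty.intro (MonomialOrder.lex (σ := σ))
  -- Among all `T` with `P = I : T`, take one with the fewest terms.
  obtain ⟨T, hT, hmin⟩ := (measure fun T : MvPolynomial σ k => T.support.card).wf.has_min
    {T | ∀ F, F ∈ P ↔ F * T ∈ I} ⟨T₀, fun F => Set.ext_iff.1 hT₀ F⟩
  rw [Set.mem_ofPred_eq] at hT
  have hT0 : T ≠ 0 := by
    rintro rfl
    exact hprime.ne_top ((Ideal.eq_top_iff_one P).2 ((hT 1).2 (by simp)))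
  -- Otherwise the leading monomial of `F` times `T` minus its leading term still has colon ideal
  -- `P`, since the discarded product lies in `I`; it has fewer terms than `T`.
  have hlead : ∀ F ∈ P, F ≠ 0 → monomial (m.degree F) (1 : k) ∈ P := by
    intro F hF hF0
    by_contra hf
    have hft : monomial (m.degree F + m.degree T) (1 : k) ∈ I := by
      refine hI _ ((hT F).1 hF) _ ?_
      rw [mem_support_iff, m.coeff_mul_of_degree_add]
      exact mul_ne_zero (m.leadingCoeff_ne_zero_iff.2 hF0) (m.leadingCoeff_ne_zero_iff.2 hT0)
    refine hmin (monomial (m.degree F) 1 * (T - monomial (m.degree T) (coeff (m.degree T) T))) ?_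
      (lt_of_le_of_lt (card_support_monomial_mul_le _ _)
        (card_support_sub_monomial_lt (m.degree_mem_support hT0)))
    intro G
    have hmem : G * monomial (m.degree F + m.degree T) (coeff (m.degree T) T) ∈ I :=
      I.mul_mem_left _ (monomial_mem_of_one hft _)
    have heq : G * (monomial (m.degree F) 1 *
        (T - monomial (m.degree T) (coeff (m.degree T) T))) =
        G * monomial (m.degree F) 1 * T -
          G * monomial (m.degree F + m.degree T) (coeff (m.degree T) T) := by
      rw [mul_sub, monomial_mul, one_mul]
      ring
    rw [heq, I.sub_mem_iff_left hmem, ← hT]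
    exact ⟨fun h => P.mul_mem_right _ h, fun h => (hprime.mem_or_mem h).resolve_right hf⟩
  have hPmon : IsMonomialIdeal P := by
    intro F
    induction h : F.support.card using Nat.strong_induction_on generalizing F with
    | _ n ih =>
      intro hF a ha
      have hF0 : F ≠ 0 := by rintro rfl; simp at ha
      have hl := hlead F hF hF0
      by_cases had : m.degree F = a
      · exact had ▸ hl
      · refine ih _ (h ▸ card_support_sub_monomial_lt (m.degree_mem_support hF0)) _ rfl
          (P.sub_mem hF (monomial_mem_of_one hl _)) a ?_
        classical
        simpa [coeff_monomial, had] using ha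
  have hle : ∀ a ∈ T.support, ∀ F ∈ P, F * monomial a (1 : k) ∈ I := by
    intro a ha F hF
    rw [F.as_sum, Finset.sum_mul]
    refine I.sum_mem fun c hc => ?_
    rw [monomial_mul, mul_one]
    refine monomial_mem_of_one (hI _ ((hT _).1 (hPmon F hF c hc)) _ ?_) _
    rw [mem_support_iff, coeff_monomial_mul, one_mul]
    exact mem_support_iff.1 ha
  refine ⟨hPmon, ?_⟩
  -- `P` lies in each `I : x^a` with `x^a` a term of `T`. If every inclusion were strict, a product
  -- of witnesses outside `P` would send `T` into `I`, against primality.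
  by_contra! hcon
  have hg : ∀ a : σ →₀ ℕ, ∃ g, a ∈ T.support → g ∉ P ∧ g * monomial a (1 : k) ∈ I := by
    intro a
    obtain ⟨F, hF⟩ := hcon a
    by_cases ha : a ∈ T.support
    · rcases hF with hF | hF
      · exact absurd (hle a ha F hF.1) hF.2
      · exact ⟨F, fun _ => hF⟩
    · exact ⟨0, fun h => absurd h ha⟩
  choose g hg using hg
  have hprod : ∏ a ∈ T.support, g a ∉ P := by
    intro h
    obtain ⟨a, ha, hga⟩ := (hprime.prod_mem_iff).1 h
    exact (hg a ha).1 hga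
  refine hprod ((hT _).2 ?_)
  have hsum : (∏ a ∈ T.support, g a) * T =
      ∑ a ∈ T.support, (∏ a ∈ T.support, g a) * monomial a (coeff a T) := by
    rw [← Finset.mul_sum, support_sum_monomial_coeff]
  rw [hsum]
  refine I.sum_mem fun a ha => ?_
  have : (monomial a) (coeff a T) = monomial a 1 * C (coeff a T) := by
    rw [mul_comm, C_mul_monomial, mul_one]
  rw [this, ← mul_assoc]
  refine I.mul_mem_right _ ?_
  obtain ⟨q, hq⟩ := Finset.dvd_prod_of_mem g ha
  rw [hq, mul_right_comm]
  exact I.mul_mem_right _ (hg a ha).2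

end MonomialIdeal

/-! ### Colourings of blow-ups and criticality -/

section Blowup

variable {V : Type*} (G : SimpleGraph V)

/-- The graph on `X` in which `x`, `y` are adjacent iff they are distinct and lie over the same
vertex or over adjacent vertices of `G`: each `v` is replaced by a clique on its fibre. -/
def blowup {X : Type*} (π : X → V) : SimpleGraph X where
  Adj x y := x ≠ y ∧ (π x = π y ∨ G.Adj (π x) (π y))
  symm := ⟨fun _ _ h => ⟨h.1.symm, h.2.imp Eq.symm SimpleGraph.Adj.symm⟩⟩
  loopless := ⟨fun _ h => h.1 rfl⟩

/-- There are `s` independent sets of `G` that cover each vertex `v` at least `b v` times. -/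
def IsMulticolorable (s : ℕ) (b : V → ℕ) : Prop :=
  ∃ S : Fin s → Set V, (∀ i, G.IsIndepSet (S i)) ∧ ∀ v, b v ≤ Nat.card {i // v ∈ S i}

variable {G}

theorem IsMulticolorable.mono {s : ℕ} {b c : V → ℕ} (h : IsMulticolorable G s b) (hcb : c ≤ b) :
    IsMulticolorable G s c := by
  obtain ⟨S, hS, hb⟩ := h
  exact ⟨S, hS, fun v => (hcb v).trans (hb v)⟩

/-- Colour classes project to independent sets, and a fibre, being a clique, uses distinct colours.
Conversely, embed the fibre over `v` into the indices of the sets containing `v`. -/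
theorem colorable_blowup_iff {X : Type*} [Finite X] (π : X → V) (s : ℕ) :
    (blowup G π).Colorable s ↔ IsMulticolorable G s fun v => Nat.card {x // π x = v} := by
  constructor
  · rintro ⟨c⟩
    refine ⟨fun i => {v | ∃ x, π x = v ∧ c x = i}, ?_, fun v => ?_⟩
    · rintro i _ ⟨x, rfl, hx⟩ _ ⟨y, rfl, hy⟩ _ hadj
      exact c.valid (v := x) (w := y) ⟨fun h => G.ne_of_adj hadj (h ▸ rfl), Or.inr hadj⟩
        (hx.trans hy.symm)
    · refine Nat.card_le_card_of_injective
        (fun x : {x // π x = v} => (⟨c x.1, x.1, x.2, rfl⟩ : {i // _})) ?_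
      rintro ⟨x, hx⟩ ⟨y, hy⟩ hxy
      by_contra hne
      exact c.valid (v := x) (w := y) ⟨fun h => hne (Subtype.ext h), Or.inl (hx.trans hy.symm)⟩
        (congrArg Subtype.val hxy)
  · rintro ⟨S, hS, hb⟩
    have hf : ∀ v, Nonempty ({x // π x = v} ↪ {i // v ∈ S i}) := fun v =>
      ⟨((Finite.equivFin _).toEmbedding.trans (Fin.castLEEmb (hb v))).trans
        (Finite.equivFin _).symm.toEmbedding⟩
    let f := fun v => (hf v).some
    have hmem : ∀ v (x : {x // π x = v}), v ∈ S (f v x).1 := fun v x => (f v x).2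
    refine ⟨SimpleGraph.Coloring.mk (fun x => (f (π x) ⟨x, rfl⟩).1) ?_⟩
    intro x y hxy heq
    by_cases hπ : π x = π y
    · have key : ∀ v (hx : π x = v) (hy : π y = v), (f v ⟨x, hx⟩).1 ≠ (f v ⟨y, hy⟩).1 :=
        fun v hx hy h => hxy.1 (congrArg Subtype.val ((f v).injective (Subtype.ext h)))
      have hc : ∀ v (hx : π x = v), (f v ⟨x, hx⟩).1 = (f (π x) ⟨x, rfl⟩).1 := by
        rintro _ rfl; rfl
      exact key (π y) hπ rfl ((hc _ hπ).trans heq)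
    · refine hS _ (hmem (π x) ⟨x, rfl⟩) ?_ hπ (hxy.2.resolve_left hπ)
      rw [heq]
      exact hmem (π y) ⟨y, rfl⟩

theorem expansion_blowup {X : Type*} (π : X → V) (W : Set X) :
    expansion (blowup G π) W = blowup G (π ∘ base W) := by
  ext a b
  simp only [expansion, blowup, Function.comp_apply]
  refine and_congr_right fun _ => ⟨?_, fun h => ?_⟩
  · rintro (h | h)
    · exact Or.inl (congrArg π h)
    · exact h.2
  · by_cases hab : base W a = base W b
    · exact Or.inl hab
    · exact Or.inr ⟨hab, h⟩

theorem induce_blowup {X : Type*} (π : X → V) (Y : Set X) :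
    (blowup G π).induce Y = blowup G (fun y : Y => π y) := by
  ext a b
  simp [blowup, Subtype.ext_iff]

theorem card_fibre_compl_singleton {X : Type*} [Finite X] [DecidableEq V] (π : X → V) (x : X)
    (v : V) : Nat.card {y : ({x}ᶜ : Set X) // π y = v} =
      Nat.card {y // π y = v} - if v = π x then 1 else 0 := by
  have e : Nat.card {y : ({x}ᶜ : Set X) // π y = v} = ({y | π y = v} \ {x}).ncard := by
    rw [← Nat.card_coe_set_eq]
    exact Nat.card_congr
      { toFun := fun y => ⟨y.1.1, y.2, y.1.2⟩
        invFun := fun y => ⟨⟨y.1, y.2.2⟩, y.2.1⟩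
        left_inv := fun _ => rfl
        right_inv := fun _ => rfl }
  have e' : Nat.card {y // π y = v} = {y | π y = v}.ncard := (Nat.card_coe_set_eq {y | π y = v})
  rw [e, e']
  split_ifs with h
  · exact Set.ncard_sdiff_singleton_of_mem h.symm
  · rw [Set.sdiff_singleton_eq_self (fun hx => h hx.symm), Nat.sub_zero]

/-- Deleting `x` from a blow-up lowers the multiplicity of the vertex below `x` by one. -/
theorem colorable_induce_blowup_iff {X : Type*} [Finite X] [DecidableEq V] (π : X → V) (x : X)
    (s : ℕ) : ((blowup G π).induce {x}ᶜ).Colorable s ↔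
      IsMulticolorable G s fun v => Nat.card {y // π y = v} - if v = π x then 1 else 0 := by
  rw [induce_blowup, colorable_blowup_iff]
  simp only [card_fibre_compl_singleton]

theorem colorable_succ_of_induce_compl_singleton {x : V} {n : ℕ}
    (h : (G.induce {x}ᶜ).Colorable n) : G.Colorable (n + 1) := by
  classical
  obtain ⟨c⟩ := h
  refine ⟨SimpleGraph.Coloring.mk
    (fun v => if hv : v = x then Fin.last n else (c ⟨v, hv⟩).castSucc) ?_⟩
  intro v w hvw
  by_cases hv : v = x <;> by_cases hw : w = x
  · exact absurd (hv.trans hw.symm) (G.ne_of_adj hvw)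
  · simpa [hv, hw] using (Fin.castSucc_lt_last _).ne'
  · simp [hv, hw]
  · simp only [hv, hw, dif_neg, not_false_eq_true, ne_eq, Fin.castSucc_inj]
    exact c.valid (v := ⟨v, hv⟩) (w := ⟨w, hw⟩) hvw

/-- Deleting a vertex lowers the chromatic number by at most one, so two colourability conditions
determine all the values. -/
theorem isCriticallyChromatic_succ_iff (n : ℕ) :
    IsCriticallyChromatic G (n + 1) ↔
      ¬ G.Colorable n ∧ ∀ x, (G.induce {x}ᶜ).Colorable n := by
  have hadd : ∀ c : ℕ∞, c + 1 = ((n + 1 : ℕ) : ℕ∞) ↔ c = n := fun c => by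
    rw [Nat.cast_add, Nat.cast_one]
    exact ENat.add_left_injective_of_ne_top (ENat.one_ne_top) |>.eq_iff
  simp only [IsCriticallyChromatic, hadd]
  constructor
  · rintro ⟨h1, h2⟩
    refine ⟨fun h => ?_, fun x => SimpleGraph.chromaticNumber_le_iff_colorable.1 (h2 x).le⟩
    have := SimpleGraph.chromaticNumber_le_iff_colorable.2 h
    rw [h1, Nat.cast_le] at this
    omega
  · rintro ⟨h1, h2⟩
    have hne : Nonempty V := by
      by_contra hV
      rw [not_nonempty_iff] at hV
      exact h1 (SimpleGraph.Colorable.of_isEmpty n)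
    refine ⟨?_, fun x => ?_⟩
    · rw [Nat.cast_add, Nat.cast_one, SimpleGraph.chromaticNumber_eq_iff_colorable_not_colorable]
      exact ⟨colorable_succ_of_induce_compl_singleton (h2 hne.some), h1⟩
    · refine le_antisymm (SimpleGraph.chromaticNumber_le_iff_colorable.2 (h2 x)) ?_
      rw [SimpleGraph.le_chromaticNumber_iff_colorable]
      intro m hm
      by_contra hlt
      rw [not_le] at hlt
      exact h1 ((colorable_succ_of_induce_compl_singleton hm).mono hlt)

end Blowup

/-! ### Monomials in powers of the cover ideal -/

section CoverIdealPowers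

variable (k : Type*) [Field k] {V : Type*} (G : SimpleGraph V)

/-- The support of a monomial in `J` is a vertex cover, the complement of an independent set. -/
theorem coverIdeal_eq_span :
    coverIdeal k G =
      Ideal.span ((fun a => monomial a (1 : k)) '' {a : V →₀ ℕ | G.IsIndepSet {v | a v = 0}}) := by
  ext f
  have hpair : ∀ i j : V, Ideal.span {X i, X j} =
      Ideal.span ((X : V → MvPolynomial V k) '' {i, j}) := fun i j => by rw [Set.image_pair]
  simp only [coverIdeal, Submodule.mem_iInf, hpair, mem_ideal_span_X_image,
    mem_ideal_span_monomial_image]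
  constructor
  · intro h a ha
    refine ⟨a, fun i hi j hj _ hij => ?_, le_rfl⟩
    obtain ⟨v, hv, hav⟩ := h i j hij a ha
    rcases hv with rfl | rfl
    · exact hav hi
    · exact hav hj
  · intro h i j hij a ha
    obtain ⟨b, hb, hba⟩ := h a ha
    by_contra! hcon
    have hzero : ∀ v ∈ ({i, j} : Set V), b v = 0 := fun v hv =>
      Nat.le_zero.1 ((hba v).trans (hcon v hv).le)
    exact hb (hzero i (by simp)) (hzero j (by simp)) (G.ne_of_adj hij) hij

theorem coverIdeal_pow_eq_span (s : ℕ) :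
    coverIdeal k G ^ s = Ideal.span ((fun a => monomial a (1 : k)) ''
      {a : V →₀ ℕ | ∃ e : Fin s → V →₀ ℕ, (∀ i, G.IsIndepSet {v | e i v = 0}) ∧ ∑ i, e i = a}) := by
  rw [coverIdeal_eq_span, Ideal.span, Submodule.span_pow]
  congr 1
  ext f
  rw [Set.mem_pow]
  constructor
  · rintro ⟨g, rfl⟩
    choose e he hg using fun i => (g i).2
    refine ⟨∑ i, e i, ⟨e, he, rfl⟩, ?_⟩
    simp only [List.prod_ofFn, ← hg, monomial_sum_one]
  · rintro ⟨_, ⟨e, he, rfl⟩, rfl⟩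
    refine ⟨fun i => ⟨monomial (e i) 1, e i, he i, rfl⟩, ?_⟩
    simp only [List.prod_ofFn, monomial_sum_one]

theorem isMonomialIdeal_coverIdeal_pow (s : ℕ) : IsMonomialIdeal (coverIdeal k G ^ s) := by
  rw [coverIdeal_pow_eq_span]
  exact isMonomialIdeal_span_monomial _

/-- A monomial lies in the `s`-th power of the cover ideal iff the complementary multiplicities
can be coloured with `s` colours. -/
theorem monomial_mem_coverIdeal_pow_iff [Finite V] (s : ℕ) (a : V →₀ ℕ) :
    monomial a (1 : k) ∈ coverIdeal k G ^ s ↔ IsMulticolorable G s fun v => s - a v := by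
  classical
  have hcard : ∀ (S : Fin s → Set V) (v : V),
      Nat.card {i // v ∈ S i} + ∑ i, (if v ∈ S i then 0 else 1) = s := by
    intro S v
    have h1 : Nat.card {i // v ∈ S i} = ∑ i, (if v ∈ S i then 1 else 0) := by
      rw [Nat.card_eq_fintype_card, Fintype.card_subtype, Finset.card_filter]
    rw [h1, ← Finset.sum_add_distrib]
    calc _ = ∑ _i : Fin s, 1 := Finset.sum_congr rfl fun i _ => by split_ifs <;> rfl
      _ = s := by simp
  rw [coverIdeal_pow_eq_span, mem_ideal_span_monomial_image]
  rw [show (monomial a (1 : k)).support = {a} by rw [support_monomial, if_neg one_ne_zero]]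
  simp only [Finset.mem_singleton, forall_eq]
  constructor
  · rintro ⟨_, ⟨e, he, rfl⟩, hle⟩
    obtain ⟨S, hS⟩ : ∃ S : Fin s → Set V, ∀ i, S i = {v | e i v = 0} := ⟨_, fun _ => rfl⟩
    refine ⟨S, fun i => hS i ▸ he i, fun v => ?_⟩
    have h1 := hcard S v
    have h2 : ∑ i, (if v ∈ S i then 0 else 1) ≤ a v := by
      refine le_trans (Finset.sum_le_sum fun i _ => ?_)
        ((Finsupp.finsetSum_apply _ _ _).symm.le.trans (hle v))
      split_ifs with hv
      · exact Nat.zero_le _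
      · rw [hS] at hv
        exact Nat.pos_of_ne_zero hv
    show s - a v ≤ _
    omega
  · rintro ⟨S, hS, hb⟩
    refine ⟨_, ⟨fun i => Finsupp.equivFunOnFinite.symm fun v => if v ∈ S i then 0 else 1,
      fun i => ?_, rfl⟩, fun v => ?_⟩
    · simpa using hS i
    · have h1 := hcard S v
      have h2 : s - a v ≤ _ := hb v
      simp only [Finsupp.finsetSum_apply, Finsupp.equivFunOnFinite_symm_apply_apply]
      omega

end CoverIdealPowers

/-! ### Associated primes as critical blow-ups -/

section Persistence

variable {k : Type*} [Field k] {V : Type*} {G : SimpleGraph V}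

theorem monomial_mem_prime_iff {P : Ideal (MvPolynomial V k)} (hP : P.IsPrime) (c : V →₀ ℕ) :
    monomial c (1 : k) ∈ P ↔ ∃ v, c v ≠ 0 ∧ X v ∈ P := by
  rw [monomial_eq, C_1, one_mul, Finsupp.prod, hP.prod_mem_iff]
  constructor
  · rintro ⟨v, hv, h⟩
    exact ⟨v, Finsupp.mem_support_iff.1 hv, hP.mem_of_pow_mem _ h⟩
  · rintro ⟨v, hv, h⟩
    exact ⟨v, Finsupp.mem_support_iff.2 hv, P.pow_mem_of_mem h _ (Nat.pos_of_ne_zero hv)⟩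

theorem exists_card_fibre_eq [Finite V] (b : V → ℕ) :
    ∃ (X : Type) (_ : Finite X) (π : X → V), ∀ v, Nat.card {x // π x = v} = b v := by
  let e := Finite.equivFin V
  refine ⟨Σ i, Fin (b (e.symm i)), inferInstance, fun x => e.symm x.1, fun v => ?_⟩
  obtain ⟨i, rfl⟩ := e.symm.surjective v
  have h := Nat.card_congr (Equiv.sigmaSubtype (β := fun i => Fin (b (e.symm i))) i)
  rw [Nat.card_fin] at h
  simpa only [e.symm.injective.eq_iff] using h

/-- An associated prime of the `s`-th power of the cover ideal comes from a critically
`(s+1)`-chromatic blow-up of `G`. -/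
theorem exists_critical_blowup_of_mem_ass [Finite V] {s : ℕ} {P : Ideal (MvPolynomial V k)}
    (hP : P ∈ Ass (coverIdeal k G ^ s)) :
    IsMonomialIdeal P ∧ ∃ (Y : Type) (_ : Finite Y) (π : Y → V),
      (∀ v, X v ∈ P ↔ v ∈ Set.range π) ∧ (∀ v, Nat.card {y // π y = v} ≤ s) ∧
        IsCriticallyChromatic (blowup G π) (s + 1) := by
  classical
  have hprime : P.IsPrime := hP.1
  obtain ⟨hmon, a, ha⟩ := (isMonomialIdeal_coverIdeal_pow k G s).exists_monomial_of_mem_ass hP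
  refine ⟨hmon, ?_⟩
  let b : V → ℕ := fun v => if (X v : MvPolynomial V k) ∈ P then s - a v else 0
  -- Multiplying `x^a` by `x^c`, which is not in `P`, makes the multiplicities `s - (c + a) v`
  -- vanish off the variables of `P`.
  let c : V →₀ ℕ := Finsupp.equivFunOnFinite.symm fun v =>
    if (X v : MvPolynomial V k) ∈ P then 0 else s
  have hca : ∀ v, s - (c + a) v = b v := by
    intro v
    simp only [c, b, Finsupp.add_apply, Finsupp.equivFunOnFinite_symm_apply_apply]
    split_ifs <;> omega
  have hb : ¬ IsMulticolorable G s b := by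
    intro h
    rw [← funext hca, ← monomial_mem_coverIdeal_pow_iff k, ← one_mul (1 : k), ← monomial_mul,
      ← ha, monomial_mem_prime_iff hprime] at h
    obtain ⟨v, hv, hvP⟩ := h
    simp [c, hvP] at hv
  have hb' : ∀ v, X v ∈ P → IsMulticolorable G s fun w => b w - if w = v then 1 else 0 := by
    intro v hv
    have h1 := (ha _).1 hv
    rw [X, monomial_mul, one_mul] at h1
    have h2 := (monomial_mem_coverIdeal_pow_iff k G s _).1
      (monomial_mem_of_le (b := Finsupp.single v 1 + (c + a)) (by gcongr; simp) h1)
    refine h2.mono fun w => ?_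
    have := hca w
    simp only [Finsupp.add_apply, Finsupp.single_apply, eq_comm (a := v)] at this ⊢
    split_ifs <;> omega
  obtain ⟨Y, hY, π, hπ⟩ := exists_card_fibre_eq b
  have hrange : ∀ v, v ∈ Set.range π ↔ b v ≠ 0 := by
    intro v
    rw [← hπ, Nat.card_ne_zero]
    exact ⟨fun ⟨y, hy⟩ => ⟨⟨y, hy⟩, inferInstance⟩, fun ⟨⟨y, hy⟩, _⟩ => ⟨y, hy⟩⟩
  have hXmem : ∀ v, X v ∈ P ↔ v ∈ Set.range π := by
    intro v
    rw [hrange]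
    constructor
    -- If `b v = 0`, the truncated decrement at `v` changes nothing, so `hb'` contradicts `hb`.
    · intro hv h0
      refine hb ((hb' v hv).mono fun w => ?_)
      by_cases hw : w = v
      · simp [hw, h0]
      · simp [hw]
    · intro h
      by_contra hv
      simp [b, hv] at h
  refine ⟨Y, hY, π, hXmem, fun v => ?_, ?_⟩
  · rw [hπ]
    simp only [b]
    split_ifs <;> omega
  · rw [isCriticallyChromatic_succ_iff]
    refine ⟨?_, fun y => ?_⟩
    · rw [colorable_blowup_iff, funext hπ]
      exact hb
    · rw [colorable_induce_blowup_iff]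
      simp only [hπ]
      exact hb' _ ((hXmem _).2 ⟨y, rfl⟩)

theorem mem_ass_of_critical_blowup [Finite V] {s : ℕ} {P : Ideal (MvPolynomial V k)}
    (hprime : P.IsPrime) (hmon : IsMonomialIdeal P) {Y : Type*} [Finite Y] {π : Y → V}
    (hP : ∀ v, X v ∈ P ↔ v ∈ Set.range π) (hs : ∀ v, Nat.card {y // π y = v} ≤ s)
    (hcrit : IsCriticallyChromatic (blowup G π) (s + 1)) : P ∈ Ass (coverIdeal k G ^ s) := by
  classical
  rw [isCriticallyChromatic_succ_iff, colorable_blowup_iff] at hcrit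
  obtain ⟨hnot, hdel⟩ := hcrit
  -- The bound `hs` makes `s - a v` recover the fibre size exactly.
  let a : V →₀ ℕ := Finsupp.equivFunOnFinite.symm fun v => s - Nat.card {y // π y = v}
  have ha : ∀ v, a v = s - Nat.card {y // π y = v} := fun _ => rfl
  have key : ∀ c : V →₀ ℕ, monomial c (1 : k) ∈ P ↔
      monomial (c + a) (1 : k) ∈ coverIdeal k G ^ s := by
    intro c
    rw [monomial_mem_prime_iff hprime, monomial_mem_coverIdeal_pow_iff]
    constructor
    · rintro ⟨v, hv, hvP⟩
      obtain ⟨y, rfl⟩ := (hP v).1 hvP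
      refine ((colorable_induce_blowup_iff π y s).1 (hdel y)).mono fun w => ?_
      have := hs w
      simp only [Finsupp.add_apply, ha]
      split_ifs with hw
      · subst hw; omega
      · omega
    · intro h
      by_contra! hc
      refine hnot (h.mono fun v => ?_)
      have := hs v
      simp only [Finsupp.add_apply, ha]
      by_cases hv : v ∈ Set.range π
      · have : c v = 0 := by
          by_contra h0
          exact hc v h0 ((hP v).2 hv)
        omega
      · have : IsEmpty {y // π y = v} := ⟨fun y => hv ⟨y.1, y.2⟩⟩
        simp
  refine ⟨hprime, monomial a 1, Set.ext fun F => ?_⟩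
  rw [SetLike.mem_coe, Set.mem_ofPred_eq]
  constructor
  · intro hF
    rw [F.as_sum, Finset.sum_mul]
    refine Ideal.sum_mem _ fun c hc => ?_
    rw [monomial_mul, mul_one]
    exact monomial_mem_of_one ((key c).1 (hmon F hF c hc)) _
  · intro hF
    exact mem_of_forall_monomial_mem fun c hc =>
      (key c).2 ((isMonomialIdeal_coverIdeal_pow k G s).mul_monomial_mem hF hc)

/-- The fibres of a critically `(s+1)`-chromatic blow-up that is not a clique over a single vertex
have at most `s` elements. -/
theorem card_fibre_le_of_critical_blowup {s : ℕ} {Y : Type*} [Finite Y] {π : Y → V}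
    (hcrit : IsCriticallyChromatic (blowup G π) (s + 1)) {v : V} (hv : ∃ y, π y ≠ v) :
    Nat.card {y // π y = v} ≤ s := by
  classical
  obtain ⟨y, hy⟩ := hv
  -- Deleting `y` leaves the fibre over `v` intact, and its size is at most the number of colours.
  obtain ⟨S, -, hS⟩ := (colorable_induce_blowup_iff π y s).1
    (((isCriticallyChromatic_succ_iff s).1 hcrit).2 y)
  have h := hS v
  beta_reduce at h
  rw [if_neg (Ne.symm hy), Nat.sub_zero] at h
  exact h.trans ((Finite.card_subtype_le _).trans (Nat.card_fin s).le)

theorem colorable_blowup_of_forall_eq {s : ℕ} {Y : Type*} [Finite Y] {π : Y → V} {v : V}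
    (h : ∀ y, π y = v) (hs : Nat.card {y // π y = v} ≤ s) : (blowup G π).Colorable s := by
  rw [colorable_blowup_iff]
  refine ⟨fun _ => {v}, fun _ => Set.pairwise_singleton _ _, fun w => ?_⟩
  by_cases hw : w = v
  · subst hw
    simpa using hs
  · have : IsEmpty {y // π y = w} := ⟨fun y => hw (y.2.symm.trans (h y.1))⟩
    simp

theorem range_comp_base {Y : Type*} (π : Y → V) (W : Set Y) :
    Set.range (π ∘ base W) = Set.range π :=
  Function.Surjective.range_comp (fun y => ⟨Sum.inl y, rfl⟩) π

theorem ass_coverIdeal_pow_subset [Finite V] {s : ℕ} (hC : ConjectureFor (s + 1)) :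
    Ass (coverIdeal k G ^ s) ⊆ Ass (coverIdeal k G ^ (s + 1)) := by
  intro P hP
  obtain ⟨hmon, Y, hY, π, hXmem, hs, hcrit⟩ := exists_critical_blowup_of_mem_ass hP
  obtain ⟨W, hW⟩ := hC Y (blowup G π) hcrit
  rw [expansion_blowup] at hW
  refine mem_ass_of_critical_blowup hP.1 hmon (fun v => ?_) (fun v => ?_) hW
  · rw [hXmem, range_comp_base]
  · refine card_fibre_le_of_critical_blowup hW ?_
    -- If everything lay over `v`, the original blow-up would be a clique on at most `s` vertices,
    -- hence `s`-colourable.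
    by_contra! hv
    exact ((isCriticallyChromatic_succ_iff s).1 hcrit).1
      (colorable_blowup_of_forall_eq (fun y => hv (Sum.inl y)) (hs v))

end Persistence

end CoverIdeal

theorem theorem2p6 {k : Type*} [Field k] {V : Type*} [Finite V] (G : SimpleGraph V) :
    (∀ s : ℕ, 1 ≤ s → CoverIdeal.ConjectureFor (s + 1) →
      CoverIdeal.Ass (CoverIdeal.coverIdeal k G ^ s) ⊆
        CoverIdeal.Ass (CoverIdeal.coverIdeal k G ^ (s + 1))) ∧
    ((∀ s : ℕ, 1 ≤ s → CoverIdeal.ConjectureFor s) →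
      CoverIdeal.HasPersistenceProperty (CoverIdeal.coverIdeal k G)) :=
  ⟨fun _ _ hC => CoverIdeal.ass_coverIdeal_pow_subset hC,
    fun hC s _ => CoverIdeal.ass_coverIdeal_pow_subset (hC (s + 1) (Nat.le_add_left 1 s))⟩
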